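/- **Conventions.** All ultrafilters $\mathcal U$, $\mathcal V$, … on $\omega$ below are nonprincipal. An ultrafilter $\mathcal{U}$ on $\omega$ is a *p-point* if for every decreasing sequence $X_0\supseteq X_1\supseteq\cdots$ of members of $\mathcal U$ there is $A\in\mathcal U$ with $A\setminus X_n$ finite for all $n$; $\mathcal V$ on $\omega$ is a *q-point* if every finite-to-one function $g:\omega\to\omega$ is one-to-one on some member of $\mathcal V$. We write $\mathcal V\le_T\mathcal W$ if there is a map $f:\mathcal W\to\mathcal V$ that sends every filter base for $\mathcal W$ to a filter base for $\mathcal V$. The *Fubini product* $\lim_{n\to\mathcal U}\mathcal V_n$ is $\{A\subseteq\omega\times\omega:\{n:\{j:(n,j)\in A\}\in\mathcal V_n\}\in\mathcal U\}$, and the *Fubini iterates of p-points* form the least class of ultrafilters on $\omega$ that contains all p-points and contains $\lim_{n\to\mathcal U}\mathcal V_n$ (transported to $\omega$ by any bijection $\omega\times\omega\to\omega$) whenever $\mathcal U$ is a p-point and all $\mathcal V_n$ are in the class. Filters are *isomorphic* if a map that is one-to-one on a member of the first carries the first to the second. Write $s\sqsubseteq X$ if the finite set $s\subset\omega$ is an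 initial segment of $X\subseteq\omega$, and $s\sqsubset X$ if moreover $s\neq X$. A *front* is a family $B$ of finite subsets of $\omega$ such that $a\not\sqsubset b$ for all $a,b\in B$, and every infinite $X\subseteq\omega$ has an initial segment in $B$. A *flat-top front* is a front $B\ne\{\emptyset\}$ such that either $B=[\omega]^1$, or every $b\in B$ has at least two elements and, with $a=b\setminus\{\max b\}$, $\{c\setminus a: c\in B,\ c\sqsupset a\}=[\omega\setminus(\max a+1)]^1$. Let $\hat B$ be the set of initial segments of members of $B$, and $\hat B^-=\hat B\setminus B$. Given ultrafilters $\vec{\mathcal U}=(\mathcal U_c:c\in\hat B^-)$ on $\omega$, a *$\vec{\mathcal U}$-tree* is a set $T\subseteq\hat B$ closed under initial segments, with $\emptyset\in T$ and $\{n:c\cup\{n\}\in T\}\in\mathcal U_c$ for every $c\in T\cap\hat B^-$. Say that $(B,\vec{\mathcal U})$ *represents* an ultrafilter $\mathcal W$ as an iterate of p-points if $B$ is a flat-top front, all $\mathcal U_c$ ($c\in\hat B^-$) are p-points, and $\mathcal W$ is isomorphic to the filter on $B$ generated by the sets $T\cap B$, $T$ a $\vec{\mathcal U}$-tree. **Theorem.**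 Let $\mathcal W$ be a Fubini iterate of p-points and let $\mathcal V$ be a q-point with $\mathcal V\le_T\mathcal W$. Then $\mathcal W$ is represented by some $(B,\vec{\mathcal U})$ as above, and for every $(B,\vec{\mathcal U})$ that represents $\mathcal W$ there are a $\vec{\mathcal U}$-tree $\tilde T$ and a finite-to-one map $\tau:\tilde T\to\omega$ such that $\tau(T)\in\mathcal V$ for every $\vec{\mathcal U}$-tree $T\subseteq\tilde T$. -/

import Mathlib

namespace FubiniTukey

/-- Nonprincipal: no finite set belongs to the ultrafilter. -/
def IsNonprincipal (U : Ultrafilter ℕ) : Prop :=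
  ∀ A : Set ℕ, A.Finite → A ∉ U

/-- A p-point: a nonprincipal ultrafilter on `ℕ` in which every decreasing sequence of members
has a pseudo-intersection (`A ⊆* X n` is `(A \ X n).Finite`). -/
def IsPPoint (U : Ultrafilter ℕ) : Prop :=
  IsNonprincipal U ∧
    ∀ X : ℕ → Set ℕ, (∀ n, X n ∈ U) → (∀ n, X (n + 1) ⊆ X n) →
      ∃ A ∈ U, ∀ n, (A \ X n).Finite

/-- A q-point: a nonprincipal ultrafilter on `ℕ` such that every finite-to-one function is
one-to-one on some member. -/
def IsQPoint (V : Ultrafilter ℕ) : Prop :=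
  IsNonprincipal V ∧
    ∀ g : ℕ → ℕ, (∀ n, (g ⁻¹' {n}).Finite) → ∃ A ∈ V, Set.InjOn g A

/-- `𝓑` is a filter base for `F`. -/
def IsFilterBase {α : Type} (F : Filter α) (𝓑 : Set (Set α)) : Prop :=
  (∀ A ∈ 𝓑, A ∈ F) ∧ ∀ A ∈ F, ∃ B ∈ 𝓑, B ⊆ A

/-- `f` (of which only the values on members of `F` matter) is a cofinal map from `F` to `G`:
it sends every filter base for `F` to a filter base for `G`. -/
def IsCofinalMap {α β : Type} (F : Filter α) (G : Filter β) (f : Set α → Set β) : Prop :=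
  (∀ A ∈ F, f A ∈ G) ∧
    ∀ 𝓑 : Set (Set α), IsFilterBase F 𝓑 → IsFilterBase G (f '' 𝓑)

/-- `TukeyLE G F` is `G ≤_T F`: there is a cofinal map from `F` to `G`. -/
def TukeyLE {β α : Type} (G : Filter β) (F : Filter α) : Prop :=
  ∃ f : Set α → Set β, IsCofinalMap F G f

/-- The Fubini product `lim_{n → U} V n` on `ℕ × ℕ`: the sets `A` with
`{n | {j | (n, j) ∈ A} ∈ V n} ∈ U`. -/
def fubiniLim (U : Ultrafilter ℕ) (V : ℕ → Ultrafilter ℕ) : Ultrafilter (ℕ × ℕ) :=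
  U.bind fun n => (V n).map (Prod.mk n)

theorem mem_fubiniLim (U : Ultrafilter ℕ) (V : ℕ → Ultrafilter ℕ) (A : Set (ℕ × ℕ)) :
    A ∈ fubiniLim U V ↔ {n | {j | (n, j) ∈ A} ∈ V n} ∈ U :=
  Iff.rfl

/-- The Fubini iterates of p-points, as ultrafilters on `ℕ`: the smallest class that contains
the p-points and contains `lim_{n → U} V n` (carried to `ℕ` by any bijection `ℕ × ℕ ≃ ℕ`)
whenever `U` is a p-point and all `V n` are in the class. -/
inductive IsFubiniIterate : Ultrafilter ℕ → Prop
  | ppoint (U : Ultrafilter ℕ) (hU : IsPPoint U) : IsFubiniIterate U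
  | lim (U : Ultrafilter ℕ) (V : ℕ → Ultrafilter ℕ) (e : ℕ × ℕ ≃ ℕ) (hU : IsPPoint U)
      (hV : ∀ n, IsFubiniIterate (V n)) : IsFubiniIterate ((fubiniLim U V).map e)

/-- `s ⊑ X`: the finite set `s` is an initial segment of `X`. -/
def IsInitSeg (s : Finset ℕ) (X : Set ℕ) : Prop :=
  (s : Set ℕ) ⊆ X ∧ ∀ x ∈ X, ∀ y ∈ s, x ≤ y → x ∈ s

/-- A front on `ℕ`. -/
def IsFront (B : Set (Finset ℕ)) : Prop :=
  (∀ a ∈ B, ∀ b ∈ B, IsInitSeg a (b : Set ℕ) → a = b) ∧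
    ∀ X : Set ℕ, X.Infinite → ∃ b ∈ B, IsInitSeg b X

/-- A flat-top front: a front `B` on `ℕ`, `B ≠ {∅}`, which is either `[ℕ]^1`, or consists of sets
with at least two elements and satisfies, for each `b ∈ B` and `a = b \ {max b}`,
`{c \ a : c ∈ B, a ⊏ c} = [ℕ \ (max a + 1)]^1`. -/
def IsFlatTopFront (B : Set (Finset ℕ)) : Prop :=
  IsFront B ∧ B ≠ {∅} ∧
    (B = {b | b.card = 1} ∨
      ((∀ b ∈ B, 2 ≤ b.card) ∧
        ∀ b ∈ B, ∀ a : Finset ℕ, a = b.erase (b.sup id) →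
          (fun c : Finset ℕ => c \ a) '' {c | c ∈ B ∧ IsInitSeg a (c : Set ℕ) ∧ a ≠ c} =
            (fun n : ℕ => ({n} : Finset ℕ)) '' {n | ∀ x ∈ a, x < n}))

/-- `B̂`: the initial segments of members of `B`. -/
def hat (B : Set (Finset ℕ)) : Set (Finset ℕ) :=
  {s | ∃ b ∈ B, IsInitSeg s (b : Set ℕ)}

/-- `B̂⁻ = B̂ \ B`. -/
def hatMinus (B : Set (Finset ℕ)) : Set (Finset ℕ) :=
  hat B \ B

/-- `T` is a `U`-tree on `B`, for `U = (U c : c ∈ B̂⁻)` (values of `U` elsewhere are ignored). -/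
def IsUTree (B : Set (Finset ℕ)) (U : Finset ℕ → Ultrafilter ℕ) (T : Set (Finset ℕ)) : Prop :=
  T ⊆ hat B ∧
    (∀ t ∈ T, ∀ s : Finset ℕ, IsInitSeg s (t : Set ℕ) → s ∈ T) ∧
    ∅ ∈ T ∧
    ∀ c ∈ T, c ∈ hatMinus B → {n : ℕ | insert n c ∈ T} ∈ U c

/-- The filter on the base `B` (as a filter on `Finset ℕ` concentrated on `B`) generated by the
sets `[T] = T ∩ B` of maximal nodes of `U`-trees `T`. -/
def treeFilter (B : Set (Finset ℕ)) (U : Finset ℕ → Ultrafilter ℕ) : Filter (Finset ℕ) :=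
  Filter.generate {A | ∃ T, IsUTree B U T ∧ A = T ∩ B}

/-- `F` and `G` are isomorphic: some map that is one-to-one on a member of `F` carries `F`
to `G`. -/
def IsIsomorphic {α β : Type} (F : Filter α) (G : Filter β) : Prop :=
  ∃ φ : α → β, (∃ A ∈ F, Set.InjOn φ A) ∧ F.map φ = G

/-- `(B, U)` represents `W` as an iterate of p-points: `B` is a flat-top front, `U c` is a p-point
for every `c ∈ B̂⁻`, and `W` is isomorphic to the filter on `B` generated by the `U`-trees. -/
def Represents (B : Set (Finset ℕ)) (U : Finset ℕ → Ultrafilter ℕ) (W : Ultrafilter ℕ) : Prop :=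
  IsFlatTopFront B ∧ (∀ c ∈ hatMinus B, IsPPoint (U c)) ∧
    IsIsomorphic (W : Filter ℕ) (treeFilter B U)

/-- `τ` is finite-to-one on `T`. -/
def FiniteToOneOn (τ : Finset ℕ → ℕ) (T : Set (Finset ℕ)) : Prop :=
  ∀ n, {t | t ∈ T ∧ τ t = n}.Finite

end FubiniTukey

namespace FubiniTukey

/-! A Tukey reduction becomes a monotone map `K` on sets of nodes, carrying trees to members of `V`
and cofinal in `V` (`exists_monotone_on_trees`). A finite set `s` of nodes forces `k` if `k ∈ K T`
for every tree `T ⊇ s`. Some `Y ∈ V` includes no infinite forced set. Below a tree `T₁` with `K T₁ ⊆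
Y`, finite sets therefore force only finitely many elements.

For each unforced pair `(s, k)` fix a tree around `s` whose value omits `k`. As all `U c` are
p-points, these countably many trees can be diagonalized: there are `T₀` and a fast sequence `N`
such that, if no node of `T ⊆ T₀` has its maximum in `[N j, N (j + 1))`, then each `k < N j` in `K
T` is forced by the nodes of `T` below `N j` (`exists_tree_decided`).

The q-point yields a set in `V` whose elements lie at least three blocks of `N` apart. Let `τ` send
a node to the element of this set in the block of its maximum or an adjacent one. If `k ∈ K T` in
this set is missed by `τ '' T`, then `T` has no maximum in three consecutive blocks around `k`. So
`k` is forced by nodes below the first of them, and hence lies below the second, which contains it: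
a contradiction.

Representations exist by recursion: `[ω]^1` serves p-points, and grafting fronts above the
singletons `{n}` serves Fubini products. -/

/-! ### Initial segments and fronts. -/

theorem IsInitSeg.refl (s : Finset ℕ) : IsInitSeg s (s : Set ℕ) :=
  ⟨subset_rfl, fun _ hx _ _ _ => hx⟩

theorem IsInitSeg.trans {s t : Finset ℕ} {X : Set ℕ} (h₁ : IsInitSeg s (t : Set ℕ))
    (h₂ : IsInitSeg t X) : IsInitSeg s X :=
  ⟨h₁.1.trans h₂.1, fun x hx y hy hxy => h₁.2 x (h₂.2 x hx y (h₁.1 hy) hxy) y hy hxy⟩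

theorem IsInitSeg.total {s t : Finset ℕ} {X : Set ℕ} (h₁ : IsInitSeg s X) (h₂ : IsInitSeg t X) :
    IsInitSeg s (t : Set ℕ) ∨ IsInitSeg t (s : Set ℕ) := by
  by_cases h : s ⊆ t
  · exact Or.inl ⟨h, fun x hx y hy hxy => h₁.2 x (h₂.1 hx) y hy hxy⟩
  · right
    obtain ⟨y, hys, hyt⟩ := Finset.not_subset.1 h
    refine ⟨fun x hx => ?_, fun x hx y hy hxy => h₂.2 x (h₁.1 hx) y hy hxy⟩
    refine h₁.2 x (h₂.1 hx) y hys ?_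
    by_contra hlt
    exact hyt (h₂.2 y (h₁.1 hys) x hx (by omega))

theorem isInitSeg_empty (X : Set ℕ) : IsInitSeg ∅ X := by
  constructor <;> simp

theorem isInitSeg_filter_lt (t : Finset ℕ) (m : ℕ) :
    IsInitSeg (t.filter (· < m)) (t : Set ℕ) := by
  refine ⟨fun x hx => ?_, fun x hx y hy hxy => ?_⟩
  · exact (Finset.mem_filter.1 hx).1
  · rw [Finset.mem_filter] at *
    exact ⟨hx, by omega⟩

theorem IsInitSeg.filter_lt_eq {s t : Finset ℕ} (h : IsInitSeg s (t : Set ℕ)) {m : ℕ}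
    (hm : m ∈ s) : s.filter (· < m) = t.filter (· < m) := by
  ext x
  simp only [Finset.mem_filter]
  exact ⟨fun hx => ⟨h.1 hx.1, hx.2⟩, fun hx => ⟨h.2 x hx.1 m hm hx.2.le, hx.2⟩⟩

theorem hat_of_isInitSeg {B : Set (Finset ℕ)} {s t : Finset ℕ} (ht : t ∈ hat B)
    (h : IsInitSeg s (t : Set ℕ)) : s ∈ hat B :=
  let ⟨b, hb, hbt⟩ := ht
  ⟨b, hb, h.trans hbt⟩

theorem subset_hat (B : Set (Finset ℕ)) : B ⊆ hat B := fun b hb => ⟨b, hb, .refl b⟩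

/-- A non-maximal node of a front can be extended by any number above it. -/
theorem IsFront.insert_mem_hat {B : Set (Finset ℕ)} (hB : IsFront B) {c : Finset ℕ}
    (hc : c ∈ hatMinus B) {n : ℕ} (hn : ∀ x ∈ c, x < n) : insert n c ∈ hat B := by
  obtain ⟨b, hb, hbX⟩ := hB.2 ((c : Set ℕ) ∪ Set.Ici n) ((Set.Ici_infinite n).mono (by simp))
  have hi : IsInitSeg (insert n c) ((c : Set ℕ) ∪ Set.Ici n) := by
    refine ⟨fun x hx => ?_, fun x hx y hy hxy => ?_⟩
    · simp only [Finset.coe_insert, Set.mem_insert_iff, Finset.mem_coe] at hx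
      rcases hx with rfl | hx
      · right; simp
      · left; exact hx
    · rw [Finset.mem_insert] at *
      rcases hx with hx | hx
      · exact Or.inr hx
      · left
        have : n ≤ x := hx
        rcases hy with rfl | hy
        · omega
        · have := hn y hy; omega
  rcases hi.total hbX with h | h
  · exact ⟨b, hb, h⟩
  by_cases hnb : n ∈ b
  · refine ⟨b, hb, fun x hx => ?_, fun x hx y hy hxy => h.1 hx⟩
    rcases Finset.mem_insert.1 (Finset.mem_coe.1 hx) with rfl | hx'
    · exact hnb
    · exact h.2 x hx n hnb (hn x hx').le
  -- Here `b` would be an initial segment of `c`, so the antichain property puts `c` itself in `B`.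
  · exfalso
    have hbc : b ⊆ c := fun x hx =>
      (Finset.mem_insert.1 (h.1 hx)).resolve_left (fun hxn => hnb (hxn ▸ hx))
    obtain ⟨b', hb', hcb'⟩ := hc.1
    have hbc' : IsInitSeg b (c : Set ℕ) :=
      ⟨hbc, fun x hx y hy hxy => h.2 x (Finset.mem_insert_of_mem hx) y hy hxy⟩
    have hbb' := hB.1 b hb b' hb' (hbc'.trans hcb')
    have hcb : c = b := Finset.Subset.antisymm (hbb' ▸ hcb'.1) hbc
    exact hc.2 (hcb ▸ hb)

/-! ### Trees of ultrafilters and their filter. -/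

theorem IsNonprincipal.eventually_gt {U : Ultrafilter ℕ} (hU : IsNonprincipal U) (c : Finset ℕ) :
    {n : ℕ | ∀ x ∈ c, x < n} ∈ U := by
  have : {n : ℕ | ∀ x ∈ c, x < n}ᶜ ∉ U := by
    refine hU _ ((Set.finite_Iic (c.sup id)).subset fun n hn => ?_)
    simp only [Set.mem_compl_iff, Set.mem_ofPred_eq, not_forall, not_lt] at hn
    obtain ⟨x, hx, hnx⟩ := hn
    exact hnx.trans (Finset.le_sup (f := id) hx)
  rwa [Ultrafilter.compl_notMem_iff] at this

theorem isUTree_hat {B : Set (Finset ℕ)} (hB : IsFront B) {U : Finset ℕ → Ultrafilter ℕ}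
    (hU : ∀ c ∈ hatMinus B, IsNonprincipal (U c)) : IsUTree B U (hat B) := by
  refine ⟨subset_rfl, fun t ht s hs => hat_of_isInitSeg ht hs, ?_, fun c _ hc => ?_⟩
  · obtain ⟨b, hb, -⟩ := hB.2 Set.univ Set.infinite_univ
    exact ⟨b, hb, isInitSeg_empty _⟩
  · exact Filter.mem_of_superset ((hU c hc).eventually_gt c) fun n hn => hB.insert_mem_hat hc hn

theorem IsUTree.inter {B : Set (Finset ℕ)} {U : Finset ℕ → Ultrafilter ℕ} {S T : Set (Finset ℕ)}
    (hS : IsUTree B U S) (hT : IsUTree B U T) : IsUTree B U (S ∩ T) :=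
  ⟨fun _ ht => hS.1 ht.1, fun t ht s hs => ⟨hS.2.1 t ht.1 s hs, hT.2.1 t ht.2 s hs⟩,
    ⟨hS.2.2.1, hT.2.2.1⟩, fun c hc hcB =>
      Filter.inter_mem (hS.2.2.2 c hc.1 hcB) (hT.2.2.2 c hc.2 hcB)⟩

theorem IsUTree.mem_treeFilter {B : Set (Finset ℕ)} {U : Finset ℕ → Ultrafilter ℕ}
    {T : Set (Finset ℕ)} (hT : IsUTree B U T) : T ∩ B ∈ treeFilter B U :=
  Filter.mem_generate_of_mem ⟨T, hT, rfl⟩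

/-- Trees are closed under intersection, so the generating sets already form a base. -/
theorem mem_treeFilter_iff {B : Set (Finset ℕ)} (hB : IsFront B) {U : Finset ℕ → Ultrafilter ℕ}
    (hU : ∀ c ∈ hatMinus B, IsNonprincipal (U c)) {X : Set (Finset ℕ)} :
    X ∈ treeFilter B U ↔ ∃ T, IsUTree B U T ∧ T ∩ B ⊆ X := by
  refine ⟨fun hX => ?_, fun ⟨T, hT, hTX⟩ => Filter.mem_of_superset hT.mem_treeFilter hTX⟩
  induction hX with
  | @basic s hs => obtain ⟨T, hT, rfl⟩ := hs; exact ⟨T, hT, subset_rfl⟩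
  | univ => exact ⟨_, isUTree_hat hB hU, Set.subset_univ _⟩
  | superset _ hst ih => obtain ⟨T, hT, h⟩ := ih; exact ⟨T, hT, h.trans hst⟩
  | inter _ _ ih₁ ih₂ =>
    obtain ⟨S, hS, h₁⟩ := ih₁
    obtain ⟨T, hT, h₂⟩ := ih₂
    exact ⟨_, hS.inter hT, fun t ht => ⟨h₁ ⟨ht.1.1, ht.2⟩, h₂ ⟨ht.1.2, ht.2⟩⟩⟩

/-! ### Monotone cofinal maps. -/

/-- A Tukey reduction of filters yields a monotone cofinal map. -/
theorem TukeyLE.exists_monotone {α β : Type} {G : Filter β} {F : Filter α} (h : TukeyLE G F) :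
    ∃ f : Set α → Set β, Monotone f ∧ (∀ A ∈ F, f A ∈ G) ∧ ∀ Y ∈ G, ∃ A ∈ F, f A ⊆ Y := by
  obtain ⟨f, hf, hbase⟩ := h
  refine ⟨fun A => ⋃ A' ∈ {A' | A' ∈ F ∧ A' ⊆ A}, f A', fun A A' hAA' => ?_, fun A hA => ?_,
    fun Y hY => ?_⟩
  · exact Set.biUnion_subset_biUnion_left fun C hC => ⟨hC.1, hC.2.trans hAA'⟩
  · exact Filter.mem_of_superset (hf A hA)
      (Set.subset_biUnion_of_mem (u := f) (show A ∈ {A' | A' ∈ F ∧ A' ⊆ A} from ⟨hA, subset_rfl⟩))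
  · by_contra! hcon
    have hbad : ∀ A ∈ F, ∃ A' ∈ F, A' ⊆ A ∧ ¬ f A' ⊆ Y := by
      intro A hA
      by_contra! hA'
      exact hcon A hA (Set.iUnion₂_subset fun C hC => hA' C hC.1 hC.2)
    -- If every member of `F` includes some `A'` with `f A' ⊄ Y`, such `A'` form a base whose image
    -- cannot be a base for `G`.
    obtain ⟨_, ⟨A, ⟨hA, hAY⟩, rfl⟩, hsub⟩ := (hbase {A | A ∈ F ∧ ¬ f A ⊆ Y}
      ⟨fun A hA => hA.1, fun A hA => by
        obtain ⟨A', h₁, h₂, h₃⟩ := hbad A hA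
        exact ⟨A', ⟨h₁, h₃⟩, h₂⟩⟩).2 Y hY
    exact hAY hsub

/-- A monotone cofinal map defined on `U`-trees, for an ultrafilter isomorphic to the tree
filter. -/
theorem exists_monotone_on_trees {B : Set (Finset ℕ)} (hB : IsFront B)
    {U : Finset ℕ → Ultrafilter ℕ} (hU : ∀ c ∈ hatMinus B, IsNonprincipal (U c))
    {α β : Type} {F : Filter α} {G : Filter β} (hF : IsIsomorphic F (treeFilter B U))
    (h : TukeyLE G F) :
    ∃ K : Set (Finset ℕ) → Set β, Monotone K ∧ (∀ T, IsUTree B U T → K T ∈ G) ∧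
      ∀ Y ∈ G, ∃ T, IsUTree B U T ∧ K T ⊆ Y := by
  obtain ⟨f, hmono, hfG, hcof⟩ := h.exists_monotone
  obtain ⟨φ, ⟨A, hA, hinj⟩, hφ⟩ := hF
  refine ⟨fun T => f (φ ⁻¹' (T ∩ B) ∩ A), fun S T hST => hmono (by gcongr), fun T hT => hfG _ ?_,
    fun Y hY => ?_⟩
  · exact Filter.inter_mem (Filter.mem_map.1 (hφ ▸ hT.mem_treeFilter)) hA
  · obtain ⟨X, hX, hXY⟩ := hcof Y hY
    have him : φ '' (X ∩ A) ∈ treeFilter B U :=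
      hφ ▸ Filter.image_mem_map (Filter.inter_mem hX hA)
    obtain ⟨T, hT, hTX⟩ := (mem_treeFilter_iff hB hU).1 him
    refine ⟨T, hT, (hmono ?_).trans hXY⟩
    rintro x ⟨hx, hxA⟩
    obtain ⟨y, ⟨hyX, hyA⟩, hxy⟩ := hTX hx
    rwa [← hinj hyA hxA hxy]

/-! ### Splitting, pseudo-intersections and pruning. -/

/-- An ultrafilter has a member that includes none of countably many given infinite sets. -/
theorem exists_mem_not_superset {ι : Type} [Countable ι] (V : Ultrafilter ℕ) (E : ι → Set ℕ) :
    ∃ Y ∈ V, ∀ i, (E i).Infinite → ¬ E i ⊆ Y := by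
  classical
  rcases isEmpty_or_nonempty ι with hι | hι
  · exact ⟨Set.univ, Filter.univ_mem, fun i => (hι.false i).elim⟩
  obtain ⟨e, he⟩ := exists_surjective_nat ι
  -- Index `n / 2` gives each infinite set one point at an even and one at an odd position. Hence
  -- neither the set of even-position values nor its complement includes it.
  obtain ⟨p, hp, hpE⟩ := Filter.extraction_forall_of_frequently
    (P := fun n k => (E (e (n / 2))).Infinite → k ∈ E (e (n / 2))) (fun n => by
      by_cases h : (E (e (n / 2))).Infinite
      · exact (Nat.frequently_atTop_iff_infinite.2 h).mono fun _ hk _ => hk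
      · exact (Filter.Eventually.of_forall fun _ hk => absurd hk h).frequently)
  set Z : Set ℕ := Set.range fun n => p (2 * n) with hZ
  rcases V.mem_or_compl_mem Z with h | h
  · refine ⟨Z, h, fun i hi hsub => ?_⟩
    obtain ⟨n, rfl⟩ := he i
    have h2 : (2 * n + 1) / 2 = n := by omega
    obtain ⟨m, hm⟩ := hsub (h2 ▸ hpE (2 * n + 1) (h2.symm ▸ hi))
    have := hp.injective hm
    omega
  · refine ⟨Zᶜ, h, fun i hi hsub => ?_⟩
    obtain ⟨n, rfl⟩ := he i
    have h2 : (2 * n) / 2 = n := by omega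
    have hmem := hpE (2 * n)
    rw [h2] at hmem
    exact hsub (hmem hi) ⟨n, rfl⟩

/-- A p-point contains, for any sequence of members, a common pseudo-intersection. -/
theorem IsPPoint.exists_diagonal {U : Ultrafilter ℕ} (hU : IsPPoint U) {R : ℕ → Set ℕ}
    (hR : ∀ n, R n ∈ U) (hanti : ∀ n, R (n + 1) ⊆ R n) :
    ∃ A ∈ U, ∀ n, ∃ g, ∀ m ∈ A, g ≤ m → m ∈ R n := by
  obtain ⟨A, hA, hfin⟩ := hU.2 R hR hanti
  refine ⟨A, hA, fun n => ?_⟩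
  obtain ⟨g, hg⟩ := (hfin n).bddAbove
  refine ⟨g + 1, fun m hm hgm => ?_⟩
  by_contra hmR
  have := hg ⟨hm, hmR⟩
  omega

/-- The subtree of the nodes `t` of `T` with each `m ∈ t` in the set assigned to `t ∩ m`. -/
def pruned (T : Set (Finset ℕ)) (A : Finset ℕ → Set ℕ) : Set (Finset ℕ) :=
  {t | t ∈ T ∧ ∀ m ∈ t, m ∈ A (t.filter (· < m))}

/-- For `n` above `c`, the conditions at the elements of `c` are unchanged in `insert n c`; the only
new one is `n ∈ A c`. -/
theorem IsUTree.pruned {B : Set (Finset ℕ)} {U : Finset ℕ → Ultrafilter ℕ}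
    (hU : ∀ c ∈ hatMinus B, IsNonprincipal (U c)) {T : Set (Finset ℕ)} (hT : IsUTree B U T)
    {A : Finset ℕ → Set ℕ} (hA : ∀ c ∈ hatMinus B, A c ∈ U c) : IsUTree B U (pruned T A) := by
  refine ⟨fun t ht => hT.1 ht.1, fun t ht s hs => ⟨hT.2.1 t ht.1 s hs, fun m hm => ?_⟩,
    ⟨hT.2.2.1, by simp⟩, fun c hc hcB => ?_⟩
  · rw [hs.filter_lt_eq hm]
    exact ht.2 m (hs.1 hm)
  · filter_upwards [hT.2.2.2 c hc.1 hcB, hA c hcB, (hU c hcB).eventually_gt c] with n h₁ h₂ h₃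
    refine ⟨h₁, fun m hm => ?_⟩
    rcases Finset.mem_insert.1 hm with rfl | hm
    · rwa [show (insert m c).filter (· < m) = c from ?_]
      ext x
      simp only [Finset.mem_filter, Finset.mem_insert]
      exact ⟨fun h => h.1.resolve_left (by omega), fun h => ⟨Or.inr h, h₃ x h⟩⟩
    · rw [show (insert n c).filter (· < m) = c.filter (· < m) from ?_]
      · exact hc.2 m hm
      · have := h₃ m hm
        rw [Finset.filter_insert, if_neg (by omega)]

/-! ### Forced elements and the diagonal tree. -/

/-- The elements forced into the value of `K` by a finite set of nodes. -/
def forced (B : Set (Finset ℕ)) (U : Finset ℕ → Ultrafilter ℕ) (K : Set (Finset ℕ) → Set ℕ)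
    (s : Finset (Finset ℕ)) : Set ℕ :=
  {k | ∀ T, IsUTree B U T → ↑s ⊆ T → k ∈ K T}

open Classical in
/-- The nodes of `T` included in `{0, …, n - 1}`. -/
noncomputable def below (T : Set (Finset ℕ)) (n : ℕ) : Finset (Finset ℕ) :=
  (Finset.range n).powerset.filter (· ∈ T)

theorem mem_below {T : Set (Finset ℕ)} {n : ℕ} {t : Finset ℕ} :
    t ∈ below T n ↔ t ⊆ Finset.range n ∧ t ∈ T := by
  simp [below]

theorem subset_range_iff_sup_lt {t : Finset ℕ} (ht : t.Nonempty) {n : ℕ} :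
    t ⊆ Finset.range n ↔ t.sup id < n := by
  obtain ⟨x, hx⟩ := ht
  constructor
  · intro h
    have hx' := Finset.mem_range.1 (h hx)
    rw [Finset.sup_lt_iff (by simp; omega)]
    exact fun y hy => Finset.mem_range.1 (h hy)
  · intro h y hy
    exact Finset.mem_range.2 ((Finset.le_sup (f := id) hy).trans_lt h)

/-- The blocks cut out by a strictly increasing sequence starting at `0` cover `ℕ`. -/
theorem exists_block {N : ℕ → ℕ} (hN : StrictMono N) (h0 : N 0 = 0) (k : ℕ) :
    ∃ j, N j ≤ k ∧ k < N (j + 1) := by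
  induction k with
  | zero => exact ⟨0, h0.le, by have := hN Nat.zero_lt_one; rw [zero_add]; omega⟩
  | succ k ih =>
    obtain ⟨j, h₁, h₂⟩ := ih
    by_cases h : k + 1 < N (j + 1)
    · exact ⟨j, by omega, h⟩
    · exact ⟨j + 1, by omega, by have := hN (Nat.lt_succ_self (j + 1)); rw [Nat.succ_eq_add_one] at this; omega⟩

/-- On a suitable tree `T₀` the values of `K` are decided at the ends of the empty blocks of a
sequence `N`, which moreover may be assumed to grow as fast as needed for the forced elements. -/
theorem exists_tree_decided {B : Set (Finset ℕ)} {U : Finset ℕ → Ultrafilter ℕ}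
    (hU : ∀ c ∈ hatMinus B, IsPPoint (U c)) (V : Ultrafilter ℕ)
    {K : Set (Finset ℕ) → Set ℕ} (hmono : Monotone K)
    (hcof : ∀ Y ∈ V, ∃ T, IsUTree B U T ∧ K T ⊆ Y) :
    ∃ (T₀ : Set (Finset ℕ)) (N : ℕ → ℕ), IsUTree B U T₀ ∧ StrictMono N ∧ N 0 = 0 ∧
      (∀ T ⊆ T₀, IsUTree B U T → ∀ j, (∀ t ∈ T, t.sup id < N j ∨ N (j + 1) ≤ t.sup id) →
        ∀ k ∈ K T, k < N j → k ∈ forced B U K (below T (N j))) ∧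
      ∀ T ⊆ T₀, ∀ j, ∀ k ∈ forced B U K (below T (N j)), k < N (j + 1) := by
  classical
  have hU' : ∀ c ∈ hatMinus B, IsNonprincipal (U c) := fun c hc => (hU c hc).1
  obtain ⟨Y, hY, hYsplit⟩ := exists_mem_not_superset V (forced B U K)
  obtain ⟨T₁, hT₁, hT₁Y⟩ := hcof Y hY
  have hfin : ∀ s : Finset (Finset ℕ), ↑s ⊆ T₁ → (forced B U K s).Finite := fun s hs => by
    by_contra hinf
    exact hYsplit s hinf fun k hk => hT₁Y (hk T₁ hT₁ hs)
  have hTr : ∀ (s : Finset (Finset ℕ)) (k : ℕ), ∃ T, IsUTree B U T ∧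
      (k ∉ forced B U K s → ↑s ⊆ T ∧ k ∉ K T) := fun s k => by
    by_cases hk : k ∈ forced B U K s
    · exact ⟨T₁, hT₁, fun h => absurd hk h⟩
    · have hk' : ¬ ∀ T, IsUTree B U T → ↑s ⊆ T → k ∈ K T := hk
      push Not at hk'
      obtain ⟨T, hT, hs, hkT⟩ := hk'
      exact ⟨T, hT, fun _ => ⟨hs, hkT⟩⟩
  choose Tr hTrU hTr using hTr
  -- `R c n` collects the one-point extensions of `c` that leave none of the finitely many trees `Tr
  -- s k` with `s ⊆ 𝒫(n)` and `k < n`.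
  let R : Finset ℕ → ℕ → Set ℕ := fun c n =>
    {m | ∀ s ∈ (Finset.range n).powerset.powerset, ∀ k ∈ Finset.range n,
      c ∈ Tr s k → insert m c ∈ Tr s k}
  have hRU : ∀ c ∈ hatMinus B, ∀ n, R c n ∈ U c := by
    intro c hc n
    have : ∀ᶠ m in (U c : Filter ℕ), ∀ s ∈ (Finset.range n).powerset.powerset,
        ∀ k ∈ Finset.range n, c ∈ Tr s k → insert m c ∈ Tr s k := by
      rw [Filter.eventually_all_finset]
      intro s _
      rw [Filter.eventually_all_finset]
      intro k _
      by_cases hcs : c ∈ Tr s k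
      · filter_upwards [(hTrU s k).2.2.2 c hcs hc] with m hm _ using hm
      · exact Filter.Eventually.of_forall fun m h => absurd h hcs
    exact this
  have hRanti : ∀ c, Antitone (R c) := by
    intro c n n' hnn' m hm s hs k hk
    have hsub : Finset.range n ⊆ Finset.range n' := by
      intro x hx; rw [Finset.mem_range] at *; omega
    exact hm s (Finset.powerset_mono.2 (Finset.powerset_mono.2 hsub) hs) k (hsub hk)
  -- The bounds `g` serve nodes `c` below `N j`. The inclusion in `R c (c.sup id + 1)` serves the
  -- others, where `N j ≤ max c`.
  have hA : ∀ c : Finset ℕ, ∃ A : Set ℕ, (c ∈ hatMinus B → A ∈ U c) ∧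
      A ⊆ R c (c.sup id + 1) ∧ ∀ n, ∃ g, ∀ m ∈ A, g ≤ m → m ∈ R c n := by
    intro c
    by_cases hc : c ∈ hatMinus B
    · obtain ⟨A, hA, hg⟩ := (hU c hc).exists_diagonal (hRU c hc) fun n => hRanti c n.le_succ
      refine ⟨A ∩ R c (c.sup id + 1), fun _ => Filter.inter_mem hA (hRU c hc _),
        Set.inter_subset_right, fun n => ?_⟩
      obtain ⟨g, hg⟩ := hg n
      exact ⟨g, fun m hm => hg m hm.1⟩
    · exact ⟨∅, fun h => absurd h hc, Set.empty_subset _, fun n => ⟨0, by simp⟩⟩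
  choose A hAU hAR g hg using hA
  have hstep : ∀ n : ℕ, ∃ n', n < n' ∧ (∀ c ⊆ Finset.range n, g c n ≤ n') ∧
      ∀ s ∈ (Finset.range n).powerset.powerset, ↑s ⊆ T₁ → ∀ k ∈ forced B U K s, k < n' := by
    intro n
    have hbdd : (⋃ s ∈ {s | s ∈ (Finset.range n).powerset.powerset ∧ ↑s ⊆ T₁},
        forced B U K s).Finite :=
      Set.Finite.biUnion ((Finset.finite_toSet _).subset fun s hs => hs.1) fun s hs => hfin s hs.2
    obtain ⟨M, hM⟩ := hbdd.bddAbove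
    refine ⟨max (n + 1) (max ((Finset.range n).powerset.sup fun c => g c n) (M + 1)),
      by omega, fun c hc => ?_, fun s hs hsT k hk => ?_⟩
    · have := Finset.le_sup (f := fun c => g c n) (Finset.mem_powerset.2 hc)
      omega
    · have := hM (Set.mem_biUnion (show s ∈ {s | s ∈ (Finset.range n).powerset.powerset ∧ ↑s ⊆ T₁}
        from ⟨hs, hsT⟩) hk)
      omega
  choose H hlt hHg hHf using hstep
  let N : ℕ → ℕ := fun j => H^[j] 0
  have hNs : ∀ j, N (j + 1) = H (N j) := fun j => Function.iterate_succ_apply' H j 0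
  refine ⟨pruned T₁ A, N, hT₁.pruned hU' hAU, strictMono_nat_of_lt_succ fun j => ?_, rfl, ?_, ?_⟩
  · rw [hNs]; exact hlt _
  · intro T hTT₀ hT j hgap k hk hkj
    by_contra hkf
    set s := below T (N j) with hs
    obtain ⟨hsTr, hkTr⟩ := hTr s k hkf
    refine hkTr (hmono ?_ hk)
    have hsP : s ∈ (Finset.range (N j)).powerset.powerset :=
      Finset.mem_powerset.2 fun t ht => Finset.mem_powerset.2 (mem_below.1 ht).1
    -- Every node of `T` lies in `Tr s k`: nodes below `N j` belong to `s`, and a node with maximum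
    -- past the empty block extends its predecessor by an element of `R c (N j)`.
    intro t
    induction t using Finset.induction_on_max with
    | empty => exact fun _ => (hTrU s k).2.2.1
    | insert m c hmc ih =>
      intro ht
      have hfil : (insert m c).filter (· < m) = c := by
        ext x
        simp only [Finset.mem_filter, Finset.mem_insert]
        exact ⟨fun h => h.1.resolve_left (by omega), fun h => ⟨Or.inr h, hmc x h⟩⟩
      have hct : IsInitSeg c ((insert m c : Finset ℕ) : Set ℕ) := by
        have := isInitSeg_filter_lt (insert m c) m
        rwa [hfil] at this
      have hcT := hT.2.1 _ ht c hct
      have hcTr := ih hcT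
      have hsup : (insert m c).sup id = m := by
        rw [Finset.sup_insert, id, sup_eq_left, Finset.sup_le_iff]
        exact fun x hx => (hmc x hx).le
      have hmA : m ∈ A c := by
        have := (hTT₀ ht).2 m (Finset.mem_insert_self m c)
        rwa [hfil] at this
      have hmR : N j ≤ m → N (j + 1) ≤ m → m ∈ R c (N j) := by
        intro h₁ h₂
        by_cases hcr : c ⊆ Finset.range (N j)
        · exact hg c _ m hmA ((hHg _ c hcr).trans ((hNs j).symm.le.trans h₂))
        · refine hRanti c ?_ (hAR c hmA)
          obtain ⟨x, hx, hxN⟩ := Finset.not_subset.1 hcr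
          rw [Finset.mem_range] at hxN
          have := Finset.le_sup (f := id) hx
          simp only [id] at this
          omega
      rcases hgap _ ht with h | h
      · exact hsTr (mem_below.2 ⟨(subset_range_iff_sup_lt ⟨m, by simp⟩).2 h, ht⟩)
      · rw [hsup] at h
        have hNN : N j < N (j + 1) := hNs j ▸ hlt _
        exact hmR (by omega) h s hsP k (Finset.mem_range.2 hkj) hcTr
  · intro T hTT₀ j k hk
    rw [hNs]
    refine hHf _ _ (Finset.mem_powerset.2 fun t ht => Finset.mem_powerset.2 (mem_below.1 ht).1)
      (fun t ht => (hTT₀ (mem_below.1 ht).2).1) k hk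

/-! ### The q-point and the finite-to-one map. -/

/-- A set in a q-point that meets each block of a partition into finite blocks at most once, and
never two blocks whose indices are at distance one or two. -/
theorem IsQPoint.exists_sparse {V : Ultrafilter ℕ} (hV : IsQPoint V) {J : ℕ → ℕ}
    (hJ : ∀ j, (J ⁻¹' {j}).Finite) :
    ∃ Y ∈ V, (∀ k ∈ Y, 1 ≤ J k) ∧ ∀ k ∈ Y, ∀ l ∈ Y, J k ≤ J l + 2 → J l ≤ J k + 2 → k = l := by
  obtain ⟨A, hA, hinj⟩ := hV.2 J hJ
  have h0 : (J ⁻¹' {0})ᶜ ∈ V := by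
    rw [Ultrafilter.compl_mem_iff_notMem]
    exact hV.1 _ (hJ 0)
  have hc : ∃ c, {k | J k % 3 = c} ∈ V := by
    have : ∀ᶠ k in (V : Filter ℕ), J k % 3 = 0 ∨ J k % 3 = 1 ∨ J k % 3 = 2 :=
      Filter.Eventually.of_forall fun k => by omega
    rw [Ultrafilter.eventually_or, Ultrafilter.eventually_or] at this
    rcases this with h | h | h
    exacts [⟨0, h⟩, ⟨1, h⟩, ⟨2, h⟩]
  obtain ⟨c, hc⟩ := hc
  refine ⟨A ∩ (J ⁻¹' {0})ᶜ ∩ {k | J k % 3 = c}, Filter.inter_mem (Filter.inter_mem hA h0) hc,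
    fun k hk => Nat.one_le_iff_ne_zero.2 hk.1.2, fun k hk l hl h₁ h₂ => hinj hk.1.1 hl.1.1 ?_⟩
  have h₃ : J k % 3 = c := hk.2
  have h₄ : J l % 3 = c := hl.2
  omega

theorem exists_finiteToOne_map {B : Set (Finset ℕ)} {U : Finset ℕ → Ultrafilter ℕ}
    (hU : ∀ c ∈ hatMinus B, IsPPoint (U c)) {V : Ultrafilter ℕ} (hV : IsQPoint V)
    {K : Set (Finset ℕ) → Set ℕ} (hmono : Monotone K) (hKV : ∀ T, IsUTree B U T → K T ∈ V)
    (hcof : ∀ Y ∈ V, ∃ T, IsUTree B U T ∧ K T ⊆ Y) :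
    ∃ (T₀ : Set (Finset ℕ)) (τ : Finset ℕ → ℕ), IsUTree B U T₀ ∧ FiniteToOneOn τ T₀ ∧
      ∀ T : Set (Finset ℕ), IsUTree B U T → T ⊆ T₀ → τ '' T ∈ V := by
  classical
  obtain ⟨T₀, N, hT₀, hN, hN0, hdec, hforced⟩ := exists_tree_decided hU V hmono hcof
  choose J hJle hJlt using exists_block hN hN0
  have hJfin : ∀ j, (J ⁻¹' {j}).Finite := fun j =>
    (Set.finite_Iio (N (j + 1))).subset fun k hk => by
      have hk : J k = j := hk
      exact hk ▸ hJlt k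
  obtain ⟨Y, hY, hY1, hYsep⟩ := hV.exists_sparse hJfin
  let near : Finset ℕ → ℕ → Prop := fun t k =>
    k ∈ Y ∧ J k ≤ J (t.sup id) + 1 ∧ J (t.sup id) ≤ J k + 1
  -- The default `J (t.sup id)` keeps `τ` finite-to-one: either way, `τ t` bounds the block of the
  -- maximum of `t`.
  let τ : Finset ℕ → ℕ := fun t => if h : ∃ k, near t k then h.choose else J (t.sup id)
  have hτ : ∀ t k, near t k → τ t = k := by
    intro t k hk
    have hex : ∃ k, near t k := ⟨k, hk⟩
    have hτt : τ t = hex.choose := dif_pos hex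
    obtain ⟨h₁, h₂, h₃⟩ := hex.choose_spec
    obtain ⟨h₄, h₅, h₆⟩ := hk
    rw [hτt]
    -- Two elements each within one block of `max t` are within two blocks of each other.
    exact hYsep _ h₁ _ h₄ (by omega) (by omega)
  refine ⟨T₀, τ, hT₀, fun n => ?_, fun T hT hTT₀ => ?_⟩
  · refine (Finset.finite_toSet (Finset.range (N (max (J n + 1) n + 1) + 1)).powerset).subset ?_
    rintro t ⟨-, htn⟩
    have hJt : J (t.sup id) ≤ max (J n + 1) n := by
      by_cases hex : ∃ k, near t k
      · obtain ⟨k, hk⟩ := hex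
        have hkn := (hτ t k hk).symm.trans htn
        subst hkn
        exact hk.2.2.trans (le_max_left _ _)
      · have : τ t = J (t.sup id) := dif_neg hex
        omega
    have hlt : t.sup id < N (max (J n + 1) n + 1) :=
      (hJlt _).trans_le (hN.monotone (by omega))
    rw [Finset.mem_coe, Finset.mem_powerset]
    intro x hx
    have := Finset.le_sup (f := id) hx
    rw [Finset.mem_range]
    simp only [id] at this hlt
    omega
  · refine Filter.mem_of_superset (Filter.inter_mem (hKV T hT) hY) fun k ⟨hkT, hkY⟩ => ?_
    by_contra hcon
    have hfar : ∀ t ∈ T, J (t.sup id) + 1 < J k ∨ J k + 1 < J (t.sup id) := by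
      intro t ht
      by_contra! h
      exact hcon ⟨t, ht, hτ t k ⟨hkY, h.1, h.2⟩⟩
    -- Since `k` avoids block `0`, there is a block `j` before its own; blocks `j`, `j + 1`, `j + 2`
    -- contain no maxima.
    obtain ⟨j, hj⟩ : ∃ j, J k = j + 1 := ⟨J k - 1, by have := hY1 k hkY; omega⟩
    have hgap : ∀ t ∈ T, t.sup id < N j ∨ N (j + 3) ≤ t.sup id := by
      intro t ht
      rcases hfar t ht with h | h
      · left
        exact (hJlt _).trans_le (hN.monotone (by omega))
      · right
        exact (hN.monotone (by omega)).trans (hJle _)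
    have h₁ : N j < N (j + 1) := hN (by omega)
    have h₂ : N (j + 1) < N (j + 2) := hN (by omega)
    have h₃ : N (j + 2) < N (j + 3) := hN (by omega)
    have hkl := hJlt k
    have hkg := hJle k
    rw [hj] at hkl hkg
    -- The last empty block makes `k` forced by nodes below `N (j + 2)`. The first two show that
    -- these are the nodes below `N j`, so forcing gives `k < N (j + 1) ≤ k`.
    have hkf := hdec T hTT₀ hT (j + 2) (fun t ht => by
      rcases hgap t ht with h | h
      · left; omega
      · right; exact h) k hkT hkl
    have hbelow : below T (N (j + 2)) = below T (N j) := by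
      ext t
      rw [mem_below, mem_below]
      refine and_congr_left fun ht => ?_
      rcases t.eq_empty_or_nonempty with rfl | hne
      · simp
      · rw [subset_range_iff_sup_lt hne, subset_range_iff_sup_lt hne]
        have := hgap t ht
        omega
    have := hforced T hTT₀ j k (hbelow ▸ hkf)
    omega

/-! ### Images of p-points and flat-top fronts. -/

theorem IsPPoint.map {U : Ultrafilter ℕ} (hU : IsPPoint U) {f : ℕ → ℕ}
    (hf : Function.Injective f) : IsPPoint (U.map f) := by
  refine ⟨fun A hA h => hU.1 _ (hA.preimage hf.injOn) h, fun X hX hanti => ?_⟩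
  obtain ⟨A, hA, hfin⟩ := hU.2 (fun n => f ⁻¹' X n) hX fun n x hx => hanti n hx
  refine ⟨f '' A, Filter.image_mem_map hA, fun n => ((hfin n).image f).subset ?_⟩
  rintro _ ⟨⟨x, hx, rfl⟩, hxn⟩
  exact ⟨x, ⟨hx, hxn⟩, rfl⟩

/-- All upper extensions of a node by one element are in `B` as soon as one of them is. -/
def IsFlat (B : Set (Finset ℕ)) : Prop :=
  ∀ (a : Finset ℕ) (m m' : ℕ), (∀ x ∈ a, x < m) → (∀ x ∈ a, x < m') → insert m a ∈ B →
    insert m' a ∈ B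

theorem sup_insert_of_forall_lt {a : Finset ℕ} {m : ℕ} (h : ∀ x ∈ a, x < m) :
    (insert m a).sup id = m := by
  rw [Finset.sup_insert, id, sup_eq_left, Finset.sup_le_iff]
  exact fun x hx => (h x hx).le

theorem erase_sup_insert {a : Finset ℕ} {m : ℕ} (h : ∀ x ∈ a, x < m) :
    (insert m a).erase ((insert m a).sup id) = a := by
  rw [sup_insert_of_forall_lt h, Finset.erase_insert fun hm => (h m hm).false]

theorem isInitSeg_insert {a : Finset ℕ} {m : ℕ} (h : ∀ x ∈ a, x < m) :
    IsInitSeg a ((insert m a : Finset ℕ) : Set ℕ) := by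
  refine ⟨by simp, fun x hx y hy hxy => ?_⟩
  have := h y hy
  exact (Finset.mem_insert.1 hx).resolve_left (by omega)

theorem exists_insert_max {b : Finset ℕ} (hb : b.Nonempty) :
    ∃ (a : Finset ℕ) (m : ℕ), (∀ x ∈ a, x < m) ∧ b = insert m a := by
  refine ⟨b.erase (b.max' hb), b.max' hb, fun x hx => ?_, (Finset.insert_erase (b.max'_mem hb)).symm⟩
  exact lt_of_le_of_ne (b.le_max' x (Finset.mem_of_mem_erase hx)) (Finset.ne_of_mem_erase hx)

theorem IsFlatTopFront.empty_notMem {B : Set (Finset ℕ)} (hB : IsFlatTopFront B) : ∅ ∉ B :=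
  fun h => hB.2.1 <| Set.eq_singleton_iff_unique_mem.2
    ⟨h, fun b hb => (hB.1.1 ∅ h b hb (isInitSeg_empty _)).symm⟩

theorem IsFlatTopFront.isFlat {B : Set (Finset ℕ)} (hB : IsFlatTopFront B) : IsFlat B := by
  intro a m m' hm hm' hmem
  rcases hB.2.2 with h | ⟨-, h⟩
  · subst h
    have hcard : (insert m a).card = 1 := hmem
    rw [Finset.card_insert_of_notMem fun h => (hm m h).false] at hcard
    obtain rfl : a = ∅ := Finset.card_eq_zero.1 (by omega)
    simp
  · have := h _ hmem a (erase_sup_insert hm).symm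
    obtain ⟨c, ⟨hcB, hac, -⟩, hc⟩ := this.symm.subset ⟨m', hm', rfl⟩
    simp only at hc
    rw [show insert m' a = c from ?_]
    · exact hcB
    · rw [← Finset.union_sdiff_of_subset (Finset.coe_subset.1 hac.1), hc, Finset.union_comm,
        Finset.singleton_union]

theorem IsFlat.isFlatTopFront {B : Set (Finset ℕ)} (hflat : IsFlat B) (hB : IsFront B)
    (hcard : ∀ b ∈ B, 2 ≤ b.card) : IsFlatTopFront B := by
  refine ⟨hB, fun h => ?_, Or.inr ⟨hcard, ?_⟩⟩
  · have := hcard ∅ (h ▸ rfl)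
    simp at this
  · rintro b hb a' rfl
    obtain ⟨a, M, hM, rfl⟩ := exists_insert_max (b := b)
      (Finset.card_pos.1 (by have := hcard b hb; omega))
    rw [erase_sup_insert hM]
    ext s
    constructor
    · rintro ⟨c, ⟨hc, hac, hne⟩, rfl⟩
      have hss : (c \ a).Nonempty := by
        rw [Finset.sdiff_nonempty]
        exact fun h => hne (Finset.Subset.antisymm (Finset.coe_subset.1 hac.1) h)
      set m := (c \ a).min' hss with hmdef
      have hmem := Finset.mem_sdiff.1 ((c \ a).min'_mem hss)
      rw [← hmdef] at hmem
      have hm : ∀ x ∈ a, x < m := fun x hx => by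
        by_contra hlt
        exact hmem.2 (hac.2 m hmem.1 x hx (by omega))
      refine ⟨m, hm, ?_⟩
      -- With `m` the first element of `c` past `a`, flatness puts `insert m a` in `B`; being an
      -- initial segment of `c`, it equals `c`.
      have heq := hB.1 _ (hflat a M m hM hm hb) c hc ⟨?_, fun x hx y hy hxy => ?_⟩
      · simp only [← heq]
        rw [Finset.insert_sdiff_of_notMem _ hmem.2, Finset.sdiff_self]
        rfl
      · intro x hx
        rcases Finset.mem_insert.1 (Finset.mem_coe.1 hx) with rfl | hx
        exacts [hmem.1, hac.1 hx]
      · rw [Finset.mem_insert] at *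
        by_cases hxa : x ∈ a
        · exact Or.inr hxa
        left
        have h₁ := (c \ a).min'_le x (Finset.mem_sdiff.2 ⟨hx, hxa⟩)
        rcases hy with rfl | hy
        · omega
        · have := hm y hy
          omega
    · rintro ⟨m, hm, rfl⟩
      refine ⟨insert m a, ⟨hflat a M m hM hm hb, isInitSeg_insert hm, fun h => ?_⟩, ?_⟩
      · have hma : m ∈ a := h ▸ Finset.mem_insert_self m a
        exact (hm m hma).false
      · simp only
        rw [Finset.insert_sdiff_of_notMem _ fun h => (hm m h).false, Finset.sdiff_self]
        rfl

/-! ### Grafting fronts above the singletons. -/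

/-- `{n} ∪ (b + n + 1)`. -/
def graftNode (n : ℕ) (b : Finset ℕ) : Finset ℕ :=
  insert n (b.map (addRightEmbedding (n + 1)))

theorem mem_graftNode {n x : ℕ} {b : Finset ℕ} :
    x ∈ graftNode n b ↔ x = n ∨ ∃ y ∈ b, y + (n + 1) = x := by
  simp [graftNode]

theorem add_mem_graftNode {n x : ℕ} {b : Finset ℕ} : x + (n + 1) ∈ graftNode n b ↔ x ∈ b := by
  rw [mem_graftNode]
  constructor
  · rintro (h | ⟨y, hy, h⟩)
    · omega
    · obtain rfl : y = x := by omega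
      exact hy
  · exact fun h => Or.inr ⟨x, h, rfl⟩

theorem self_mem_graftNode (n : ℕ) (b : Finset ℕ) : n ∈ graftNode n b :=
  Finset.mem_insert_self _ _

theorem graftNode_ne_empty (n : ℕ) (b : Finset ℕ) : graftNode n b ≠ ∅ :=
  Finset.insert_ne_empty _ _

theorem le_of_mem_graftNode {n x : ℕ} {b : Finset ℕ} (h : x ∈ graftNode n b) : n ≤ x := by
  rcases mem_graftNode.1 h with h | ⟨y, -, h⟩ <;> omega

theorem graftNode_inj {n m : ℕ} {a b : Finset ℕ} :
    graftNode n a = graftNode m b ↔ n = m ∧ a = b := by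
  refine ⟨fun h => ?_, by rintro ⟨rfl, rfl⟩; rfl⟩
  have h₁ := le_of_mem_graftNode (h ▸ self_mem_graftNode n a)
  have h₂ := le_of_mem_graftNode (h.symm ▸ self_mem_graftNode m b)
  obtain rfl : n = m := by omega
  refine ⟨rfl, ?_⟩
  ext x
  rw [← add_mem_graftNode (n := n), h, add_mem_graftNode]

theorem graftNode_empty (n : ℕ) : graftNode n ∅ = insert n ∅ := by
  simp [graftNode]

theorem graftNode_insert (n m : ℕ) (a : Finset ℕ) :
    graftNode n (insert m a) = insert (m + (n + 1)) (graftNode n a) := by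
  simp only [graftNode, Finset.map_insert, addRightEmbedding_apply]
  exact Finset.insert_comm _ _ _

theorem card_graftNode (n : ℕ) (b : Finset ℕ) : (graftNode n b).card = b.card + 1 := by
  rw [graftNode, Finset.card_insert_of_notMem, Finset.card_map]
  simp only [Finset.mem_map, addRightEmbedding_apply, not_exists, not_and]
  intro x _
  omega

theorem exists_graftNode {s : Finset ℕ} (hs : s ≠ ∅) : ∃ n a, s = graftNode n a := by
  have hs := Finset.nonempty_iff_ne_empty.2 hs
  refine ⟨s.min' hs, (s.erase (s.min' hs)).image (· - (s.min' hs + 1)), ?_⟩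
  ext x
  have hlt : ∀ y ∈ s, y ≠ s.min' hs → s.min' hs + 1 ≤ y := fun y hy hne =>
    lt_of_le_of_ne (s.min'_le y hy) hne.symm
  simp only [mem_graftNode, Finset.mem_image, Finset.mem_erase]
  constructor
  · intro hx
    by_cases hxm : x = s.min' hs
    · exact Or.inl hxm
    · exact Or.inr ⟨_, ⟨x, ⟨hxm, hx⟩, rfl⟩, Nat.sub_add_cancel (hlt x hx hxm)⟩
  · rintro (rfl | ⟨_, ⟨y, ⟨hym, hy⟩, rfl⟩, rfl⟩)
    · exact s.min'_mem hs
    · rwa [Nat.sub_add_cancel (hlt y hy hym)]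

theorem isInitSeg_graftNode {n : ℕ} {a : Finset ℕ} {X : Set ℕ} (hn : n ∈ X)
    (hX : ∀ x ∈ X, n ≤ x) :
    IsInitSeg (graftNode n a) X ↔ IsInitSeg a {x | x + (n + 1) ∈ X} := by
  constructor
  · intro h
    exact ⟨fun x hx => h.1 (add_mem_graftNode.2 hx), fun x hx y hy hxy =>
      add_mem_graftNode.1 (h.2 _ hx _ (add_mem_graftNode.2 hy) (by omega))⟩
  · intro h
    refine ⟨fun x hx => ?_, fun x hx y hy hxy => ?_⟩
    · rcases mem_graftNode.1 hx with rfl | ⟨y, hy, rfl⟩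
      · exact hn
      · exact h.1 hy
    · have := hX x hx
      rcases this.eq_or_lt with rfl | hlt
      · exact self_mem_graftNode _ _
      · obtain ⟨z, rfl⟩ : ∃ z, x = z + (n + 1) := ⟨x - (n + 1), by omega⟩
        rcases mem_graftNode.1 hy with rfl | ⟨w, hw, rfl⟩
        · omega
        · exact add_mem_graftNode.2 (h.2 z hx w hw (by omega))

theorem graftNode_isInitSeg_graftNode {n m : ℕ} {a b : Finset ℕ} :
    IsInitSeg (graftNode n a) (graftNode m b : Set ℕ) ↔ n = m ∧ IsInitSeg a (b : Set ℕ) := by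
  have hset : ∀ n, {x | x + (n + 1) ∈ (graftNode n b : Set ℕ)} = (b : Set ℕ) := fun n => by
    ext x; exact add_mem_graftNode
  constructor
  · intro h
    have h₁ := le_of_mem_graftNode (Finset.mem_coe.1 (h.1 (self_mem_graftNode n a)))
    have h₂ := le_of_mem_graftNode (h.2 m (self_mem_graftNode m b) n (self_mem_graftNode n a) h₁)
    obtain rfl : n = m := by omega
    refine ⟨rfl, ?_⟩
    rwa [isInitSeg_graftNode (self_mem_graftNode _ _) fun x hx => le_of_mem_graftNode hx,
      hset] at h
  · rintro ⟨rfl, h⟩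
    rwa [isInitSeg_graftNode (self_mem_graftNode _ _) fun x hx => le_of_mem_graftNode hx, hset]

theorem isInitSeg_empty_iff {s : Finset ℕ} : IsInitSeg s ((∅ : Finset ℕ) : Set ℕ) ↔ s = ∅ := by
  refine ⟨fun h => ?_, fun h => h ▸ isInitSeg_empty _⟩
  simpa using h.1

/-- The family of all `{n} ∪ (b + n + 1)` with `b ∈ B n`. -/
def graft (B : ℕ → Set (Finset ℕ)) : Set (Finset ℕ) :=
  {s | ∃ n, ∃ b ∈ B n, s = graftNode n b}

theorem graftNode_mem_graft {B : ℕ → Set (Finset ℕ)} {n : ℕ} {b : Finset ℕ} :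
    graftNode n b ∈ graft B ↔ b ∈ B n := by
  constructor
  · rintro ⟨m, c, hc, h⟩
    obtain ⟨rfl, rfl⟩ := graftNode_inj.1 h
    exact hc
  · exact fun h => ⟨n, b, h, rfl⟩

theorem graftNode_mem_hat {B : ℕ → Set (Finset ℕ)} {n : ℕ} {a : Finset ℕ} :
    graftNode n a ∈ hat (graft B) ↔ a ∈ hat (B n) := by
  constructor
  · rintro ⟨_, ⟨m, b, hb, rfl⟩, h⟩
    obtain ⟨rfl, hab⟩ := graftNode_isInitSeg_graftNode.1 h
    exact ⟨b, hb, hab⟩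
  · rintro ⟨b, hb, h⟩
    exact ⟨_, graftNode_mem_graft.2 hb, graftNode_isInitSeg_graftNode.2 ⟨rfl, h⟩⟩

theorem graftNode_mem_hatMinus {B : ℕ → Set (Finset ℕ)} {n : ℕ} {a : Finset ℕ} :
    graftNode n a ∈ hatMinus (graft B) ↔ a ∈ hatMinus (B n) :=
  and_congr graftNode_mem_hat (not_congr graftNode_mem_graft)

theorem empty_notMem_graft (B : ℕ → Set (Finset ℕ)) : ∅ ∉ graft B := by
  rintro ⟨n, b, -, h⟩
  exact graftNode_ne_empty n b h.symm

theorem isFront_graft {B : ℕ → Set (Finset ℕ)} (hB : ∀ n, IsFront (B n)) : IsFront (graft B) := by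
  refine ⟨?_, fun X hX => ?_⟩
  · rintro _ ⟨n, a, ha, rfl⟩ _ ⟨m, b, hb, rfl⟩ h
    obtain ⟨rfl, hab⟩ := graftNode_isInitSeg_graftNode.1 h
    rw [(hB n).1 a ha b hb hab]
  · have hn : sInf X ∈ X := Nat.sInf_mem hX.nonempty
    have hle : ∀ x ∈ X, sInf X ≤ x := fun x hx => Nat.sInf_le hx
    set n := sInf X
    have hinf : {x | x + (n + 1) ∈ X}.Infinite := by
      intro hfin
      refine hX (((hfin.image (· + (n + 1))).union (Set.finite_singleton n)).subset fun x hx => ?_)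
      rcases (hle x hx).eq_or_lt with h | h
      · exact Or.inr h.symm
      · have hx' : x - (n + 1) + (n + 1) = x := by omega
        exact Or.inl ⟨x - (n + 1), show x - (n + 1) + (n + 1) ∈ X by rwa [hx'], hx'⟩
    obtain ⟨b, hb, hbX⟩ := (hB n).2 _ hinf
    exact ⟨_, graftNode_mem_graft.2 hb, (isInitSeg_graftNode hn hle).2 hbX⟩

/-- No `B n` contains `∅`, so no singleton is in the graft; above `{n}`, flatness is inherited from
`B n` by translation. -/
theorem isFlatTopFront_graft {B : ℕ → Set (Finset ℕ)} (hB : ∀ n, IsFlatTopFront (B n)) :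
    IsFlatTopFront (graft B) := by
  refine IsFlat.isFlatTopFront ?_ (isFront_graft fun n => (hB n).1) ?_
  · intro a m m' hm hm' h
    by_cases ha : a = ∅
    · subst ha
      rw [← graftNode_empty, graftNode_mem_graft] at h
      exact absurd h (hB m).empty_notMem
    · obtain ⟨n, a, rfl⟩ := exists_graftNode ha
      have hn := hm n (self_mem_graftNode n a)
      have hn' := hm' n (self_mem_graftNode n a)
      obtain ⟨m, rfl⟩ : ∃ k, m = k + (n + 1) := ⟨m - (n + 1), by omega⟩
      obtain ⟨m', rfl⟩ : ∃ k, m' = k + (n + 1) := ⟨m' - (n + 1), by omega⟩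
      rw [← graftNode_insert, graftNode_mem_graft] at *
      refine (hB n).isFlat a m m' (fun x hx => ?_) (fun x hx => ?_) h
      · have := hm _ (add_mem_graftNode.2 hx); omega
      · have := hm' _ (add_mem_graftNode.2 hx); omega
  · rintro _ ⟨n, b, hb, rfl⟩
    have : b.card ≠ 0 := fun h => (hB n).empty_notMem (Finset.card_eq_zero.1 h ▸ hb)
    rw [card_graftNode]
    omega

/-! ### Ultrafilters and trees on a graft. -/

open Classical in
/-- The ultrafilters on the nodes of `graft B`: `U` at the root, shifted copies of `V n` above
`{n}`. -/
noncomputable def graftUltrafilter (U : Ultrafilter ℕ) (V : ℕ → Finset ℕ → Ultrafilter ℕ)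
    (c : Finset ℕ) : Ultrafilter ℕ :=
  if h : ∃ p : ℕ × Finset ℕ, c = graftNode p.1 p.2 then
    (V h.choose.1 h.choose.2).map (· + (h.choose.1 + 1))
  else U

theorem graftUltrafilter_empty (U : Ultrafilter ℕ) (V : ℕ → Finset ℕ → Ultrafilter ℕ) :
    graftUltrafilter U V ∅ = U :=
  dif_neg fun ⟨p, hp⟩ => graftNode_ne_empty p.1 p.2 hp.symm

theorem graftUltrafilter_graftNode (U : Ultrafilter ℕ) (V : ℕ → Finset ℕ → Ultrafilter ℕ) (n : ℕ)
    (a : Finset ℕ) : graftUltrafilter U V (graftNode n a) = (V n a).map (· + (n + 1)) := by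
  have h : ∃ p : ℕ × Finset ℕ, graftNode n a = graftNode p.1 p.2 := ⟨(n, a), rfl⟩
  have hspec := graftNode_inj.1 h.choose_spec
  rw [graftUltrafilter, dif_pos h, ← hspec.1, ← hspec.2]

theorem isPPoint_graftUltrafilter {B : ℕ → Set (Finset ℕ)} {U : Ultrafilter ℕ}
    {V : ℕ → Finset ℕ → Ultrafilter ℕ} (hU : IsPPoint U)
    (hV : ∀ n, ∀ c ∈ hatMinus (B n), IsPPoint (V n c)) :
    ∀ c ∈ hatMinus (graft B), IsPPoint (graftUltrafilter U V c) := by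
  intro c hc
  by_cases hce : c = ∅
  · rwa [hce, graftUltrafilter_empty]
  · obtain ⟨n, a, rfl⟩ := exists_graftNode hce
    rw [graftUltrafilter_graftNode]
    exact (hV n a (graftNode_mem_hatMinus.1 hc)).map (add_left_injective _)

theorem isUTree_graft {B : ℕ → Set (Finset ℕ)} (hB : ∀ n, IsFront (B n)) {U : Ultrafilter ℕ}
    {V : ℕ → Finset ℕ → Ultrafilter ℕ} {D : Set ℕ} (hD : D ∈ U) {S : ℕ → Set (Finset ℕ)}
    (hS : ∀ n ∈ D, IsUTree (B n) (V n) (S n)) :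
    IsUTree (graft B) (graftUltrafilter U V)
      {t | t = ∅ ∨ ∃ n ∈ D, ∃ a ∈ S n, t = graftNode n a} := by
  refine ⟨?_, ?_, Or.inl rfl, ?_⟩
  · rintro _ (rfl | ⟨n, hn, a, ha, rfl⟩)
    · obtain ⟨b, hb, -⟩ := (isFront_graft hB).2 Set.univ Set.infinite_univ
      exact ⟨b, hb, isInitSeg_empty _⟩
    · exact graftNode_mem_hat.2 ((hS n hn).1 ha)
  · rintro _ (rfl | ⟨n, hn, a, ha, rfl⟩) s hs
    · exact Or.inl (isInitSeg_empty_iff.1 hs)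
    · by_cases hse : s = ∅
      · exact Or.inl hse
      · obtain ⟨m, c, rfl⟩ := exists_graftNode hse
        obtain ⟨rfl, hca⟩ := graftNode_isInitSeg_graftNode.1 hs
        exact Or.inr ⟨m, hn, c, (hS m hn).2.1 a ha c hca, rfl⟩
  · rintro _ (rfl | ⟨n, hn, a, ha, rfl⟩) hc
    · rw [graftUltrafilter_empty]
      filter_upwards [hD] with n hn
      exact Or.inr ⟨n, hn, ∅, (hS n hn).2.2.1, (graftNode_empty n).symm⟩
    · rw [graftUltrafilter_graftNode, Ultrafilter.mem_map]
      filter_upwards [(hS n hn).2.2.2 a ha (graftNode_mem_hatMinus.1 hc)] with m hm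
      exact Or.inr ⟨n, hn, _, hm, (graftNode_insert n m a).symm⟩

theorem IsUTree.branch {B : ℕ → Set (Finset ℕ)} {U : Ultrafilter ℕ}
    {V : ℕ → Finset ℕ → Ultrafilter ℕ} {T : Set (Finset ℕ)}
    (hT : IsUTree (graft B) (graftUltrafilter U V) T) {n : ℕ} (hn : graftNode n ∅ ∈ T) :
    IsUTree (B n) (V n) {a | graftNode n a ∈ T} := by
  refine ⟨fun a ha => graftNode_mem_hat.1 (hT.1 ha), fun a ha s hs =>
    hT.2.1 _ ha _ (graftNode_isInitSeg_graftNode.2 ⟨rfl, hs⟩), hn, fun c hc hcB => ?_⟩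
  have := hT.2.2.2 _ hc (graftNode_mem_hatMinus.2 hcB)
  rw [graftUltrafilter_graftNode, Ultrafilter.mem_map] at this
  filter_upwards [this] with m hm
  have hm : insert (m + (n + 1)) (graftNode n c) ∈ T := hm
  rwa [← graftNode_insert] at hm

/-- A tree on the graft amounts to a `U`-large set of first elements `n` with a tree on each `B n`,
so the tree filter is itself a Fubini product. -/
theorem mem_treeFilter_graft {B : ℕ → Set (Finset ℕ)} (hB : ∀ n, IsFront (B n))
    {U : Ultrafilter ℕ} {V : ℕ → Finset ℕ → Ultrafilter ℕ} (hU : IsPPoint U)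
    (hV : ∀ n, ∀ c ∈ hatMinus (B n), IsPPoint (V n c)) {X : Set (Finset ℕ)} :
    X ∈ treeFilter (graft B) (graftUltrafilter U V) ↔
      {n | {b | graftNode n b ∈ X} ∈ treeFilter (B n) (V n)} ∈ U := by
  have hV' : ∀ n, ∀ c ∈ hatMinus (B n), IsNonprincipal (V n c) := fun n c hc => (hV n c hc).1
  rw [mem_treeFilter_iff (isFront_graft hB) fun c hc => (isPPoint_graftUltrafilter hU hV c hc).1]
  constructor
  · rintro ⟨T, hT, hTX⟩
    have hroot := hT.2.2.2 ∅ hT.2.2.1 ⟨hT.1 hT.2.2.1, empty_notMem_graft B⟩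
    rw [graftUltrafilter_empty] at hroot
    filter_upwards [hroot] with n hn
    have hn : insert n ∅ ∈ T := hn
    rw [← graftNode_empty] at hn
    exact (mem_treeFilter_iff (hB n) (hV' n)).2
      ⟨_, hT.branch hn, fun b hb => hTX ⟨hb.1, graftNode_mem_graft.2 hb.2⟩⟩
  · intro h
    have hS : ∀ n, ∃ S, {b | graftNode n b ∈ X} ∈ treeFilter (B n) (V n) →
        IsUTree (B n) (V n) S ∧ S ∩ B n ⊆ {b | graftNode n b ∈ X} := fun n => by
      by_cases hn : {b | graftNode n b ∈ X} ∈ treeFilter (B n) (V n)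
      · obtain ⟨S, hS⟩ := (mem_treeFilter_iff (hB n) (hV' n)).1 hn
        exact ⟨S, fun _ => hS⟩
      · exact ⟨∅, fun h => absurd h hn⟩
    choose S hS using hS
    refine ⟨_, isUTree_graft hB h fun n hn => (hS n hn).1, ?_⟩
    rintro _ ⟨rfl | ⟨n, hn, a, ha, rfl⟩, hB'⟩
    · exact absurd hB' (empty_notMem_graft B)
    · exact (hS n hn).2 ⟨ha, graftNode_mem_graft.1 hB'⟩

/-! ### Representation of Fubini iterates. -/

theorem isFront_card_eq_one : IsFront {b | b.card = 1} := by
  refine ⟨fun a ha b hb h => ?_, fun X hX => ?_⟩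
  · have ha : a.card = 1 := ha
    have hb : b.card = 1 := hb
    exact Finset.eq_of_subset_of_card_le (Finset.coe_subset.1 h.1) (by omega)
  · have hn : sInf X ∈ X := Nat.sInf_mem hX.nonempty
    refine ⟨{sInf X}, Finset.card_singleton _, by simpa using hn, fun x hx y hy hxy => ?_⟩
    rw [Finset.mem_singleton] at *
    have := Nat.sInf_le hx
    omega

theorem represents_of_isPPoint {W : Ultrafilter ℕ} (hW : IsPPoint W) :
    Represents {b | b.card = 1} (fun _ => W) W := by
  have hempty : ∅ ∉ {b : Finset ℕ | b.card = 1} := fun h => by simp at h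
  have hhat : ∀ n, ({n} : Finset ℕ) ∈ {b : Finset ℕ | b.card = 1} := Finset.card_singleton
  refine ⟨⟨isFront_card_eq_one, fun h => ?_, Or.inl rfl⟩, fun _ _ => hW, fun n => {n},
    ⟨Set.univ, Filter.univ_mem, Finset.singleton_injective.injOn⟩, ?_⟩
  · exact hempty (h ▸ rfl)
  · ext X
    rw [mem_treeFilter_iff isFront_card_eq_one fun _ _ => hW.1, Filter.mem_map]
    constructor
    · intro hX
      refine ⟨{t | t = ∅ ∨ ∃ n, {n} ∈ X ∧ t = {n}}, ⟨?_, ?_, Or.inl rfl, ?_⟩, ?_⟩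
      · rintro _ (rfl | ⟨n, -, rfl⟩)
        · exact ⟨{0}, hhat 0, isInitSeg_empty _⟩
        · exact subset_hat _ (hhat n)
      · rintro _ (rfl | ⟨n, hn, rfl⟩) s hs
        · exact Or.inl (isInitSeg_empty_iff.1 hs)
        · exact (Finset.subset_singleton_iff.1 (Finset.coe_subset.1 hs.1)).imp id
            fun h => ⟨n, hn, h⟩
      · rintro _ (rfl | ⟨n, hn, rfl⟩) hc
        · filter_upwards [hX] with n hn
          exact Or.inr ⟨n, hn, rfl⟩
        · exact absurd (hhat n) hc.2
      · rintro _ ⟨rfl | ⟨n, hn, rfl⟩, hB⟩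
        · exact absurd hB hempty
        · exact hn
    · rintro ⟨T, hT, hTX⟩
      filter_upwards [hT.2.2.2 ∅ hT.2.2.1 ⟨hT.1 hT.2.2.1, hempty⟩] with n hn
      exact hTX ⟨hn, hhat n⟩

/-- The isomorphisms `φ n` of the factors glue to `(n, j) ↦ graftNode n (φ n j)`, injective where
each `φ n` is because a grafted node determines `n`. -/
theorem represents_fubiniLim {U : Ultrafilter ℕ} (hU : IsPPoint U) {V : ℕ → Ultrafilter ℕ}
    {B : ℕ → Set (Finset ℕ)} {V' : ℕ → Finset ℕ → Ultrafilter ℕ}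
    (h : ∀ n, Represents (B n) (V' n) (V n)) (e : ℕ × ℕ ≃ ℕ) :
    Represents (graft B) (graftUltrafilter U V') ((fubiniLim U V).map e) := by
  have hpp : ∀ n, ∀ c ∈ hatMinus (B n), IsPPoint (V' n c) := fun n => (h n).2.1
  refine ⟨isFlatTopFront_graft fun n => (h n).1, isPPoint_graftUltrafilter hU hpp, ?_⟩
  choose φ hinj hmap using fun n => (h n).2.2
  choose A hA hinj using hinj
  refine ⟨fun x => graftNode (e.symm x).1 (φ (e.symm x).1 (e.symm x).2),
    ⟨{x | (e.symm x).2 ∈ A (e.symm x).1}, ?_, fun x hx y hy hxy => ?_⟩, ?_⟩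
  · refine (mem_fubiniLim U V _).2 (Filter.univ_mem' fun n => ?_)
    simpa using hA n
  · obtain ⟨h₁, h₂⟩ := graftNode_inj.1 hxy
    have hx : (e.symm x).2 ∈ A (e.symm x).1 := hx
    have hy : (e.symm y).2 ∈ A (e.symm y).1 := hy
    rw [← h₁] at h₂ hy
    exact e.symm.injective (Prod.ext h₁ (hinj _ hx hy h₂))
  · ext X
    rw [mem_treeFilter_graft (fun n => (h n).1.1) hU hpp]
    simp_rw [← hmap]
    refine (mem_fubiniLim U V _).trans (iff_of_eq ?_)
    congr 1
    ext n
    simp [Filter.mem_map, Set.preimage]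

theorem IsFubiniIterate.exists_represents {W : Ultrafilter ℕ} (hW : IsFubiniIterate W) :
    ∃ (B : Set (Finset ℕ)) (U : Finset ℕ → Ultrafilter ℕ), Represents B U W := by
  induction hW with
  | ppoint W hW => exact ⟨_, _, represents_of_isPPoint hW⟩
  | lim U V e hU _ ih =>
    choose B V' h using ih
    exact ⟨_, _, represents_fubiniLim hU h e⟩

end FubiniTukey

theorem theorem5p1 (W V : Ultrafilter ℕ)
    (hW : FubiniTukey.IsFubiniIterate W) (hV : FubiniTukey.IsQPoint V)
    (hVW : FubiniTukey.TukeyLE (V : Filter ℕ) (W : Filter ℕ)) :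
    (∃ (B : Set (Finset ℕ)) (U : Finset ℕ → Ultrafilter ℕ), FubiniTukey.Represents B U W) ∧
      ∀ (B : Set (Finset ℕ)) (U : Finset ℕ → Ultrafilter ℕ), FubiniTukey.Represents B U W →
        ∃ (T₀ : Set (Finset ℕ)) (τ : Finset ℕ → ℕ),
          FubiniTukey.IsUTree B U T₀ ∧ FubiniTukey.FiniteToOneOn τ T₀ ∧
            ∀ T : Set (Finset ℕ), FubiniTukey.IsUTree B U T → T ⊆ T₀ → τ '' T ∈ V := by
  refine ⟨hW.exists_represents, fun B U h => ?_⟩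
  obtain ⟨K, hmono, hKV, hcof⟩ := FubiniTukey.exists_monotone_on_trees h.1.1
    (fun c hc => (h.2.1 c hc).1) h.2.2 hVW
  exact FubiniTukey.exists_finiteToOne_map h.2.1 hV hmono hKV hcof
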